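/- Let $n\ge 1$ and let $T_1,\dots,T_n$ be independent random variables with the unit exponential distribution $\mathrm{Exp}(1)$ (density $e^{-t}$, $t>0$). Let $T_{(1)}\le T_{(2)}\le\dots\le T_{(n)}$ be their order statistics, and put $T_{(0)}\equiv 0$. Then for every $1\le k\le n$ the spacing $T_{(k)}-T_{(k-1)}$ has the exponential distribution $\mathrm{Exp}(n-k+1)$ with mean $1/(n-k+1)$, or equivalently the normalized spacing satisfies $$(n-k+1)\,\bigl(T_{(k)}-T_{(k-1)}\bigr)\ \stackrel{d}{=}\ T_1\sim\mathrm{Exp}(1).$$ -/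

import Mathlib

open MeasureTheory ProbabilityTheory

/-- The order statistics of a sample `x 0, …, x (n - 1)` of real numbers, numbered from `1` to `n`:
`orderStat x k` is the `k`-th smallest sample value (with multiplicity) for `1 ≤ k ≤ n`, and
`orderStat x 0 = 0` by convention. (Numbers `k > n` get the dummy value `0`.) -/
noncomputable def orderStat {n : ℕ} (x : Fin n → ℝ) : ℕ → ℝ
  | 0 => 0
  | k + 1 => if h : k < n then x (Tuple.sort x ⟨k, h⟩) else 0

/-- The `k`-th spacing `T_(k) - T_(k-1)` of the random sample `T`, as a random variable
(used for `1 ≤ k ≤ n`, so that `k - 1` is the true predecessor). -/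
noncomputable def spacing {Ω : Type*} {n : ℕ} (T : Fin n → Ω → ℝ) (k : ℕ) (ω : Ω) : ℝ :=
  orderStat (fun i => T i ω) k - orderStat (fun i => T i ω) (k - 1)

/-! Almost surely, the spacing after the `k` smallest values exceeds `s` exactly when some `k`-set
`A` of indices has all other values more than `s` above its maximum (`lt_orderStat_sub_iff`), and
these events are disjoint. Given the values in `A`, with maximum `M`, the event has probability `exp
(-(n - k) * (M + s))`, so passing from gap `0` to gap `s` costs the factor `exp (-(n - k) * s)`
whatever `A` is (`pi_gapEvent`). Summing over `A`, the tail is this factor times the probability of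
a positive spacing, which is `1`. The sup norm plays the role of `M`; it vanishes for empty `A`,
matching `T_(0) = 0`. -/

/-- The tail function of the exponential distribution. -/
lemma expMeasure_Ioi {r : ℝ} (hr : 0 < r) {s : ℝ} (hs : 0 ≤ s) :
    expMeasure r (Set.Ioi s) = ENNReal.ofReal (Real.exp (-(r * s))) := by
  have := isProbabilityMeasure_expMeasure hr
  have h1 : expMeasure r (Set.Iic s) = ENNReal.ofReal (1 - Real.exp (-(r * s))) := by
    rw [← ofReal_cdf, cdf_expMeasure_eq hr, if_pos hs]
  have h2 : Real.exp (-(r * s)) ≤ 1 := Real.exp_le_one_iff.2 (by nlinarith)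
  rw [← Set.compl_Iic, prob_compl_eq_one_sub measurableSet_Iic, h1, ← ENNReal.ofReal_one,
    ← ENNReal.ofReal_sub _ (by linarith)]
  congr 1
  ring

instance nullSingletonClass_expMeasure (r : ℝ) : NullSingletonClass (expMeasure r) := by
  unfold expMeasure gammaMeasure
  infer_instance

lemma ae_pos_expMeasure {r : ℝ} (hr : 0 < r) : ∀ᵐ t ∂expMeasure r, 0 < t := by
  have := isProbabilityMeasure_expMeasure hr
  have h := expMeasure_Ioi hr le_rfl
  rw [mul_zero, neg_zero, Real.exp_zero, ENNReal.ofReal_one] at h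
  exact mem_ae_iff.2 ((prob_compl_eq_zero_iff measurableSet_Ioi).2 h)

/-- A random variable with exponential tail function is exponentially distributed. -/
lemma hasLaw_expMeasure_of_tail {Ω : Type*} [MeasurableSpace Ω] {P : Measure Ω}
    [IsProbabilityMeasure P] {r : ℝ} (hr : 0 < r) {Z : Ω → ℝ} (hZ : AEMeasurable Z P)
    (h : ∀ s, 0 ≤ s → P {ω | s < Z ω} = ENNReal.ofReal (Real.exp (-(r * s)))) :
    HasLaw Z (expMeasure r) P := by
  have := isProbabilityMeasure_expMeasure hr
  have := Measure.isProbabilityMeasure_map hZ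
  have key : ∀ s, 0 ≤ s → P.map Z (Set.Ioi s) = expMeasure r (Set.Ioi s) := fun s hs => by
    rw [Measure.map_apply_of_aemeasurable hZ measurableSet_Ioi, expMeasure_Ioi hr hs]
    exact h s hs
  have key' : ∀ s, 0 ≤ s → P.map Z (Set.Iic s) = expMeasure r (Set.Iic s) := fun s hs => by
    rw [← Set.compl_Ioi, prob_compl_eq_one_sub measurableSet_Ioi,
      prob_compl_eq_one_sub measurableSet_Ioi, key s hs]
  have zero : expMeasure r (Set.Iic 0) = 0 := by
    rw [← ofReal_cdf, cdf_expMeasure_eq hr, if_pos le_rfl]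
    simp
  refine ⟨hZ, Measure.ext_of_Iic _ _ fun a => ?_⟩
  rcases le_total 0 a with ha | ha
  · exact key' a ha
  -- The tail at `0` is `1`, so neither law charges `(-∞, 0]`.
  · rw [measure_mono_null (Set.Iic_subset_Iic.2 ha) zero,
      measure_mono_null (Set.Iic_subset_Iic.2 ha) ((key' 0 le_rfl).trans zero)]

section OrderStatistics

variable {n : ℕ}

lemma orderStat_succ (x : Fin n → ℝ) {k : ℕ} (hk : k < n) :
    orderStat x (k + 1) = x (Tuple.sort x ⟨k, hk⟩) := by
  simp [orderStat, hk]

lemma orderStat_succ_le_iff (x : Fin n → ℝ) {k : ℕ} (hk : k < n) (t : ℝ) :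
    orderStat x (k + 1) ≤ t ↔ k < (Finset.univ.filter fun i => x i ≤ t).card := by
  rw [orderStat_succ x hk]
  have h := Tuple.lt_card_le_iff_apply_le_of_monotone (j := ⟨k, hk⟩) (a := t)
    (Tuple.monotone_sort x)
  have hc : (Finset.univ.filter fun i => (x ∘ Tuple.sort x) i ≤ t).card =
      (Finset.univ.filter fun i => x i ≤ t).card :=
    Finset.card_bij (fun i _ => Tuple.sort x i) (by simp)
      (fun _ _ _ _ h => (Tuple.sort x).injective h)
      (fun b hb => ⟨(Tuple.sort x).symm b, by simpa using hb, by simp⟩)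
  rw [hc] at h
  exact h.symm

lemma measurable_orderStat (k : ℕ) : Measurable fun x : Fin n → ℝ => orderStat x k := by
  rcases k with _ | k
  · exact measurable_const
  by_cases hk : k < n
  · refine measurable_of_Iic fun t => ?_
    have : (fun x : Fin n → ℝ => orderStat x (k + 1)) ⁻¹' Set.Iic t =
        {x | k < ∑ i, if x i ≤ t then 1 else 0} := by
      ext x
      simp only [Set.mem_preimage, Set.mem_Iic, orderStat_succ_le_iff x hk, Finset.card_filter,
        Set.mem_ofPred_eq]
    rw [this]
    refine measurableSet_lt measurable_const (Finset.measurable_fun_sum _ fun i _ => ?_)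
    exact Measurable.ite (measurableSet_le (measurable_pi_apply i) measurable_const)
      measurable_const measurable_const
  · simp only [orderStat, hk, dite_false]
    exact measurable_const

/-- The event that the sample values outside `A` exceed all those in `A` (and `0`) by more
than `s`. -/
def gapEvent (A : Finset (Fin n)) (s : ℝ) : Set (Fin n → ℝ) :=
  {x | ∀ i : {i // ¬ i ∈ A}, ‖fun j : {j // j ∈ A} => x j‖ + s < x i}

lemma measurableSet_gapEvent (A : Finset (Fin n)) (s : ℝ) : MeasurableSet (gapEvent A s) := by
  rw [gapEvent, Set.ofPred_forall]
  refine MeasurableSet.iInter fun i => measurableSet_lt ?_ (measurable_pi_apply _)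
  exact ((measurable_pi_lambda _ fun j => measurable_pi_apply _).norm).add_const s

lemma le_norm_restrict (x : Fin n → ℝ) {A : Finset (Fin n)} {j : Fin n} (hj : j ∈ A) :
    x j ≤ ‖fun j : {j // j ∈ A} => x j‖ :=
  (le_abs_self _).trans (norm_le_pi_norm (fun j : {j // j ∈ A} => x j) ⟨j, hj⟩)

/-- For `i ∈ A \ B` and `j ∈ B \ A`, membership in both events would give `x i + s < x j` and `x j +
s < x i`. -/
lemma disjoint_gapEvent {A B : Finset (Fin n)} (hcard : A.card = B.card) (hAB : A ≠ B)
    {s : ℝ} (hs : 0 ≤ s) : Disjoint (gapEvent A s) (gapEvent B s) := by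
  refine Set.disjoint_left.2 fun x hxA hxB => ?_
  have h1 : ¬ A ⊆ B := fun h => hAB (Finset.eq_of_subset_of_card_le h hcard.ge)
  have h2 : ¬ B ⊆ A := fun h => hAB (Finset.eq_of_subset_of_card_le h hcard.le).symm
  obtain ⟨i, hiA, hiB⟩ := Finset.not_subset.1 h1
  obtain ⟨j, hjB, hjA⟩ := Finset.not_subset.1 h2
  have h3 := hxA ⟨j, hjA⟩
  have h4 := hxB ⟨i, hiB⟩
  have h5 := le_norm_restrict x hiA
  have h6 := le_norm_restrict x hjB
  linarith

/-- The `(k + 1)`-st spacing exceeds `s` if and only if some `k` sample values are separated from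
the others by a gap exceeding `s`. -/
lemma lt_orderStat_sub_iff {x : Fin n → ℝ} (hx : ∀ i, 0 ≤ x i) {k : ℕ} (hk : k < n) {s : ℝ} :
    s < orderStat x (k + 1) - orderStat x k ↔
      ∃ A ∈ Finset.powersetCard k Finset.univ, x ∈ gapEvent A s := by
  constructor
  · intro h
    -- The witness is the set of indices of the `k` smallest values.
    refine ⟨(Finset.univ.filter fun j : Fin n => (j : ℕ) < k).map (Tuple.sort x).toEmbedding,
      ?_, ?_⟩
    · simp [Finset.mem_powersetCard, Fin.card_filter_val_lt, hk.le]
    · rintro ⟨i, hi⟩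
      obtain ⟨i, rfl⟩ := (Tuple.sort x).surjective i
      have hik : k ≤ i := by simpa using hi
      have hmono : orderStat x (k + 1) ≤ x (Tuple.sort x i) := by
        rw [orderStat_succ x hk]
        exact Tuple.monotone_sort x (show (⟨k, hk⟩ : Fin n) ≤ i from hik)
      have h0 : 0 ≤ orderStat x k := by
        rcases k with _ | k
        · exact le_rfl
        · rw [orderStat_succ x (by omega)]
          exact hx _
      refine lt_of_le_of_lt ?_ ((lt_sub_iff_add_lt'.1 h).trans_le hmono)
      refine add_le_add_left ((pi_norm_le_iff_of_nonneg h0).2 ?_) s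
      rintro ⟨j, hj⟩
      obtain ⟨j, rfl⟩ := (Tuple.sort x).surjective j
      have hjk : (j : ℕ) < k := by simpa using hj
      rw [Real.norm_of_nonneg (hx _)]
      rcases k with _ | k
      · omega
      · rw [orderStat_succ x (by omega)]
        exact Tuple.monotone_sort x (show j ≤ (⟨k, by omega⟩ : Fin n) from Nat.le_of_lt_succ hjk)
  · rintro ⟨A, hA, h⟩
    have hcard : A.card = k := (Finset.mem_powersetCard.1 hA).2
    have h1 : orderStat x k ≤ ‖fun j : {j // j ∈ A} => x j‖ := by
      rcases k with _ | k
      · exact norm_nonneg _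
      · rw [orderStat_succ_le_iff x (by omega), ← Nat.succ_le_iff, Nat.succ_eq_add_one, ← hcard]
        exact Finset.card_le_card fun j hj => by simpa using le_norm_restrict x hj
    have h2 : ‖fun j : {j // j ∈ A} => x j‖ + s < orderStat x (k + 1) := by
      -- Only indices in `A` can have values at most `‖x|_A‖ + s`, so there are at most `k` of them.
      rw [← not_le, orderStat_succ_le_iff x hk, not_lt, ← hcard]
      refine Finset.card_le_card fun i hi => ?_
      by_contra hiA
      exact absurd (h ⟨i, hiA⟩) (not_lt.2 (by simpa using hi))
    linarith

lemma orderStat_lt_succ {x : Fin n → ℝ} (hx : ∀ i, 0 < x i) (hinj : ∀ i j, i ≠ j → x i ≠ x j)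
    {k : ℕ} (hk : k < n) : orderStat x k < orderStat x (k + 1) := by
  rw [orderStat_succ x hk]
  rcases k with _ | k
  · exact hx _
  · rw [orderStat_succ x (by omega)]
    refine lt_of_le_of_ne (Tuple.monotone_sort x ?_) (hinj _ _ ?_)
    · exact Fin.mk_le_mk.2 (Nat.le_succ k)
    · simp

end OrderStatistics

section ExponentialSample

variable {n : ℕ}

/-- Two coordinates have joint law `μ.prod μ`, for which the diagonal is null by Fubini, since `μ`
has no atoms. -/
lemma ae_ne_pi {ι : Type*} [Fintype ι] (μ : Measure ℝ) [IsProbabilityMeasure μ] [NullSingletonClass μ]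
    {i j : ι} (hij : i ≠ j) : ∀ᵐ x ∂Measure.pi fun _ : ι => μ, x i ≠ x j := by
  have hind : iIndepFun (fun (i : ι) (x : ι → ℝ) => x i) (Measure.pi fun _ : ι => μ) :=
    iIndepFun_pi (X := fun _ => id) fun _ => aemeasurable_id
  have hprod := (indepFun_iff_map_prod_eq_prod_map_map (measurable_pi_apply i).aemeasurable
    (measurable_pi_apply j).aemeasurable).1 (hind.indepFun hij)
  have hm : ∀ i, (Measure.pi fun _ : ι => μ).map (fun x => x i) = μ := fun i =>
    (measurePreserving_eval (fun _ : ι => μ) i).map_eq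
  rw [hm, hm] at hprod
  have hd : ∀ᵐ p ∂(μ.prod μ), p.1 ≠ p.2 := by
    have hmeas : MeasurableSet {p : ℝ × ℝ | p.1 ≠ p.2} :=
      (measurableSet_eq_fun measurable_fst measurable_snd).compl
    refine (Measure.ae_prod_iff_ae_ae hmeas).2 (ae_of_all _ fun a => ?_)
    filter_upwards [Measure.ae_ne μ a] with b hb using hb.symm
  rw [← hprod] at hd
  exact ae_of_ae_map ((measurable_pi_apply i).prodMk (measurable_pi_apply j)).aemeasurable hd

lemma ae_pos_pi : ∀ᵐ x ∂Measure.pi fun _ : Fin n => expMeasure 1, ∀ i, 0 < x i := by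
  have := isProbabilityMeasure_expMeasure one_pos
  exact ae_all_iff.2 fun i => (Measure.quasiMeasurePreserving_eval
    (fun _ : Fin n => expMeasure 1) i).ae (ae_pos_expMeasure one_pos)

/-- Lack of memory: enlarging the required gap by `s` costs a factor `exp (-s)` for each of the
sample values outside `A`. -/
lemma pi_gapEvent (A : Finset (Fin n)) {s : ℝ} (hs : 0 ≤ s) :
    Measure.pi (fun _ : Fin n => expMeasure 1) (gapEvent A s) =
      ENNReal.ofReal (Real.exp (-(((n : ℝ) - A.card) * s))) *
        Measure.pi (fun _ : Fin n => expMeasure 1) (gapEvent A 0) := by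
  have := isProbabilityMeasure_expMeasure one_pos
  have hcard : (Fintype.card {i // ¬ i ∈ A} : ℝ) = (n : ℝ) - A.card := by
    rw [Fintype.card_subtype_compl, Fintype.card_fin, Fintype.card_coe,
      Nat.cast_sub (by simpa using A.card_le_univ)]
  -- `ν`, the law of the coordinates in `A`, does not depend on `t`, so the integrands for `t = s`
  -- and `t = 0` can be compared pointwise.
  obtain ⟨ν, main⟩ : ∃ ν : Measure ({i // i ∈ A} → ℝ), ∀ t : ℝ, 0 ≤ t →
      Measure.pi (fun _ : Fin n => expMeasure 1) (gapEvent A t) =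
        ∫⁻ y, ENNReal.ofReal (Real.exp (-(((n : ℝ) - A.card) * (‖y‖ + t)))) ∂ν := by
    refine ⟨@Measure.pi _ _ (Subtype.fintype fun i => i ∈ A) _ fun _ => expMeasure 1,
      fun t ht => ?_⟩
    let F : Set (({i // i ∈ A} → ℝ) × ({i // ¬ i ∈ A} → ℝ)) := {p | ∀ i, ‖p.1‖ + t < p.2 i}
    have hF : MeasurableSet F := by
      simp only [F, Set.ofPred_forall]
      exact MeasurableSet.iInter fun i => measurableSet_lt (measurable_fst.norm.add_const t)
        ((measurable_pi_apply i).comp measurable_snd)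
    have hpre : gapEvent A t =
        MeasurableEquiv.piEquivPiSubtypeProd (fun _ => ℝ) (fun i => i ∈ A) ⁻¹' F := rfl
    rw [hpre, (measurePreserving_piEquivPiSubtypeProd (fun _ : Fin n => expMeasure 1)
      (fun i => i ∈ A)).measure_preimage hF.nullMeasurableSet, Measure.prod_apply hF]
    refine lintegral_congr fun y => ?_
    have hbox : Prod.mk y ⁻¹' F = Set.univ.pi fun _ => Set.Ioi (‖y‖ + t) := by
      ext z
      simp [F]
    rw [hbox, Measure.pi_pi, Finset.prod_const, Finset.card_univ,
      expMeasure_Ioi one_pos (by positivity), ← ENNReal.ofReal_pow (Real.exp_pos _).le,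
      ← Real.exp_nat_mul, hcard]
    congr 2
    ring
  rw [main s hs, main 0 le_rfl, ← lintegral_const_mul' _ _ ENNReal.ofReal_ne_top]
  refine lintegral_congr fun y => ?_
  rw [← ENNReal.ofReal_mul (Real.exp_pos _).le, ← Real.exp_add]
  congr 2
  ring

lemma pi_lt_orderStat_sub_eq_sum {k : ℕ} (hk : k < n) {s : ℝ} (hs : 0 ≤ s) :
    Measure.pi (fun _ : Fin n => expMeasure 1)
        {x | s < orderStat x (k + 1) - orderStat x k} =
      ∑ A ∈ Finset.powersetCard k Finset.univ,
        Measure.pi (fun _ : Fin n => expMeasure 1) (gapEvent A s) := by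
  rw [← measure_biUnion_finset _ fun A _ => measurableSet_gapEvent A s]
  · refine measure_congr ?_
    filter_upwards [ae_pos_pi] with x hx
    refine propext ((lt_orderStat_sub_iff (fun i => (hx i).le) hk).trans ?_)
    change _ ↔ x ∈ ⋃ A ∈ Finset.powersetCard k Finset.univ, gapEvent A s
    simp only [Set.mem_iUnion, exists_prop]
  · intro A hA B hB hAB
    exact disjoint_gapEvent ((Finset.mem_powersetCard.1 hA).2.trans
      (Finset.mem_powersetCard.1 hB).2.symm) hAB hs

lemma pi_lt_orderStat_sub {k : ℕ} (hk : k < n) {s : ℝ} (hs : 0 ≤ s) :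
    Measure.pi (fun _ : Fin n => expMeasure 1)
        {x | s < orderStat x (k + 1) - orderStat x k} =
      ENNReal.ofReal (Real.exp (-(((n : ℝ) - k) * s))) := by
  have := isProbabilityMeasure_expMeasure one_pos
  have hone : Measure.pi (fun _ : Fin n => expMeasure 1)
      {x | 0 < orderStat x (k + 1) - orderStat x k} = 1 := by
    rw [← measure_univ (μ := Measure.pi fun _ : Fin n => expMeasure 1)]
    refine measure_congr (Filter.eventuallyEq_univ.2 ?_)
    have hne : ∀ᵐ x ∂Measure.pi fun _ : Fin n => expMeasure 1, ∀ i j, i ≠ j → x i ≠ x j :=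
      ae_all_iff.2 fun i => ae_all_iff.2 fun j => by
        by_cases hij : i = j
        · simp [hij]
        · simpa [hij] using ae_ne_pi (expMeasure 1) hij
    filter_upwards [ae_pos_pi, hne] with x hx hx'
    exact sub_pos.2 (orderStat_lt_succ hx hx' hk)
  -- Writing `1` as the probability of a positive spacing lets both sides be expanded over the same
  -- sets `A`.
  rw [← mul_one (ENNReal.ofReal _), ← hone, pi_lt_orderStat_sub_eq_sum hk hs,
    pi_lt_orderStat_sub_eq_sum hk le_rfl, Finset.mul_sum]
  refine Finset.sum_congr rfl fun A hA => ?_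
  rw [pi_gapEvent A hs, (Finset.mem_powersetCard.1 hA).2]

end ExponentialSample

theorem mainTheorem2 {Ω : Type*} [MeasurableSpace Ω] (P : Measure Ω) [IsProbabilityMeasure P]
    (n : ℕ) (T : Fin n → Ω → ℝ)
    (hindep : iIndepFun T P) (hlaw : ∀ i, HasLaw (T i) (expMeasure 1) P)
    (k : ℕ) (hk : 1 ≤ k) (hkn : k ≤ n) :
    HasLaw (fun ω => spacing T k ω) (expMeasure ((n : ℝ) - k + 1)) P ∧
    HasLaw (fun ω => ((n : ℝ) - k + 1) * spacing T k ω) (expMeasure 1) P ∧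
    IdentDistrib (fun ω => ((n : ℝ) - k + 1) * spacing T k ω)
      (T ⟨0, lt_of_lt_of_le hk hkn⟩) P P := by
  obtain ⟨k, rfl⟩ : ∃ j, k = j + 1 := ⟨k - 1, by omega⟩
  have hr : (n : ℝ) - (k + 1 : ℕ) + 1 = n - k := by push_cast; ring
  rw [hr]
  have hpos : (0 : ℝ) < n - k := sub_pos.2 (by exact_mod_cast hkn)
  have hpi : HasLaw (fun ω i => T i ω) (Measure.pi fun _ : Fin n => expMeasure 1) P :=
    hindep.hasLaw_pi hlaw
  have hmeas : Measurable fun x : Fin n → ℝ => orderStat x (k + 1) - orderStat x k :=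
    (measurable_orderStat _).sub (measurable_orderStat _)
  have htail : ∀ s, 0 ≤ s →
      P {ω | s < spacing T (k + 1) ω} = ENNReal.ofReal (Real.exp (-(((n : ℝ) - k) * s))) :=
    fun s hs => (hpi.measure_eq (p := fun x => s < orderStat x (k + 1) - orderStat x k)
      (measurableSet_lt measurable_const hmeas)).trans (pi_lt_orderStat_sub hkn hs)
  have hsp : AEMeasurable (fun ω => spacing T (k + 1) ω) P := hmeas.comp_aemeasurable hpi.aemeasurable
  have hnorm : HasLaw (fun ω => ((n : ℝ) - k) * spacing T (k + 1) ω) (expMeasure 1) P := by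
    refine hasLaw_expMeasure_of_tail one_pos (hsp.const_mul _) fun s hs => ?_
    simp only [← div_lt_iff₀' hpos]
    rw [htail _ (by positivity), mul_div_cancel₀ _ hpos.ne', one_mul]
  refine ⟨hasLaw_expMeasure_of_tail hpos hsp htail, hnorm, hnorm.aemeasurable,
    (hlaw _).aemeasurable, ?_⟩
  rw [hnorm.map_eq, (hlaw _).map_eq]
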